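/- For $n\ge 1$ let $$B_n=\langle \sigma_1,\dots,\sigma_{n-1}\mid \sigma_i\sigma_j=\sigma_j\sigma_i\ (|i-j|\ge 2),\ \sigma_i\sigma_j\sigma_i=\sigma_j\sigma_i\sigma_j\ (|i-j|=1)\rangle$$ be the braid group on $n$ strands. Put $\delta=\sigma_{n-1}\sigma_{n-2}\cdots\sigma_1$ and $U_j=(\sigma_{j-1}\cdots\sigma_2\sigma_1)(\sigma_1\sigma_2\cdots\sigma_{j-1})$ for $2\le j\le n$. The induced permutation of braids is the homomorphism $\beta\mapsto\pi_\beta$ from $B_n$ to the permutations of $\{1,\dots,n\}$ (with $(\pi_1\circ\pi_2)(i)=\pi_1(\pi_2(i))$) that sends $\sigma_i$ to the transposition of $i$ and $i+1$. A permutation braid is a braid that is represented by a positive word in the $\sigma_i$ in whose diagram no pair of strands crosses more than once. **Theorem.** Let $n$ and $k$ be coprime integers with $2\le k\le n-1$, and let $a_i=\lceil ni/k\rceil$ for $1\le i\le k-1$. Then the $n$-braid $\delta^k$ is conjugate in $B_n$ to $\delta\,U_{a_1}U_{a_2}\cdots U_{a_{k-1}}$. More precisely, let $\pi_k$ be the permutation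 of $\{1,\dots,n\}$ with $\pi_k(i)\equiv ki \pmod n$ for $1\le i\le n$. There is a unique permutation braid $X_k\in B_n$ whose induced permutation is $\pi_k$, and $$X_k^{-1}\,\delta^k\,X_k=\delta\,U_{a_1}U_{a_2}\cdots U_{a_{k-1}}.$$ -/

import Mathlib

/-- The indices `1, …, n - 1` of the standard generators of the braid group on `n` strands. -/
abbrev BraidGen (n : ℕ) : Type := {i : ℕ // i ∈ Finset.Ico 1 n}

/-- The endpoints `1, …, n` of the strands of an `n`-braid. -/
abbrev BraidPt (n : ℕ) : Type := {i : ℕ // i ∈ Finset.Icc 1 n}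

/-- The Artin relators: `σ_i σ_j = σ_j σ_i` when the indices differ by at least `2`, and
`σ_i σ_j σ_i = σ_j σ_i σ_j` when they differ by `1` (each unordered pair is listed once). -/
def braidRels (n : ℕ) : Set (FreeGroup (BraidGen n)) :=
  {r | ∃ i j : BraidGen n, i.1 + 2 ≤ j.1 ∧
      r = FreeGroup.of i * FreeGroup.of j * (FreeGroup.of j * FreeGroup.of i)⁻¹} ∪
  {r | ∃ i j : BraidGen n, i.1 + 1 = j.1 ∧
      r = FreeGroup.of i * FreeGroup.of j * FreeGroup.of i *
        (FreeGroup.of j * FreeGroup.of i * FreeGroup.of j)⁻¹}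

/-- The braid group `B_n`, by its Artin presentation. -/
abbrev BraidGroup (n : ℕ) : Type := PresentedGroup (braidRels n)

/-- The standard generator `σ_i` of `B_n` for `1 ≤ i ≤ n - 1` (and `1` for other `i`). -/
def braidSigma (n i : ℕ) : BraidGroup n :=
  if h : i ∈ Finset.Ico 1 n then PresentedGroup.of ⟨i, h⟩ else 1

/-- `D_j = σ_{j-1} ⋯ σ_2 σ_1` in `B_n`. -/
def braidD (n j : ℕ) : BraidGroup n :=
  ((List.range' 1 (j - 1)).reverse.map (braidSigma n)).prod

/-- `E_j = σ_1 σ_2 ⋯ σ_{j-1}` in `B_n`. -/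
def braidE (n j : ℕ) : BraidGroup n :=
  ((List.range' 1 (j - 1)).map (braidSigma n)).prod

/-- `U_j = (σ_{j-1} ⋯ σ_1)(σ_1 ⋯ σ_{j-1})` in `B_n`. -/
def braidU (n j : ℕ) : BraidGroup n := braidD n j * braidE n j

/-- `δ = σ_{n-1} ⋯ σ_2 σ_1` in `B_n`. -/
def braidDelta (n : ℕ) : BraidGroup n := braidD n n

/-- The transposition of the endpoints `i` and `i + 1`. -/
def adjSwap {n : ℕ} (i : BraidGen n) : Equiv.Perm (BraidPt n) :=
  Equiv.swap
    ⟨i.1, Finset.mem_Icc.2 ⟨(Finset.mem_Ico.1 i.2).1, (Finset.mem_Ico.1 i.2).2.le⟩⟩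
    ⟨i.1 + 1, Finset.mem_Icc.2 ⟨Nat.succ_pos _, (Finset.mem_Ico.1 i.2).2⟩⟩

theorem adjSwap_val {n : ℕ} (i : BraidGen n) (p : BraidPt n) :
    (adjSwap i p).1 = if p.1 = i.1 then i.1 + 1 else if p.1 = i.1 + 1 then i.1 else p.1 := by
  unfold adjSwap
  rw [Equiv.swap_apply_def]
  simp only [Subtype.ext_iff]
  split_ifs <;> rfl

theorem adjSwap_rels (n : ℕ) :
    ∀ r ∈ braidRels n, FreeGroup.lift (fun i : BraidGen n => adjSwap i) r = 1 := by
  rintro r (⟨i, j, hij, rfl⟩ | ⟨i, j, hij, rfl⟩)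
  · simp only [map_mul, map_inv, FreeGroup.lift_apply_of]
    rw [mul_inv_eq_one]
    ext p
    simp only [Equiv.Perm.mul_apply, adjSwap_val]
    grind
  · simp only [map_mul, map_inv, FreeGroup.lift_apply_of]
    rw [mul_inv_eq_one]
    ext p
    simp only [Equiv.Perm.mul_apply, adjSwap_val]
    grind

/-- The induced permutation `π_β`, sending `i` to the left endpoint of the strand of `β` whose
right endpoint is `i` (braids are drawn from left to right). It satisfies
`π_{αβ} = π_α ∘ π_β`, and `π_{σ_i}` exchanges `i` and `i + 1`. -/
def inducedPerm (n : ℕ) : BraidGroup n →* Equiv.Perm (BraidPt n) :=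
  PresentedGroup.toGroup (f := fun i : BraidGen n => adjSwap i) (adjSwap_rels n)

/-- The crossings of the positive diagram of the word `σ_{i_1} σ_{i_2} ⋯`, read from left to right,
each recorded as the unordered pair of the strands that cross there; a strand is named by its left
endpoint. The first letter `σ_i` crosses the strands `i` and `i + 1`, and the strand that starts at
the point `p` to the right of that crossing is the strand `adjSwap i p` of the whole diagram. -/
def wordCrossings {n : ℕ} : List (BraidGen n) → List (Sym2 (BraidPt n))
  | [] => []
  | i :: w =>
      s(⟨i.1, Finset.mem_Icc.2 ⟨(Finset.mem_Ico.1 i.2).1, (Finset.mem_Ico.1 i.2).2.le⟩⟩,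
        ⟨i.1 + 1, Finset.mem_Icc.2 ⟨Nat.succ_pos _, (Finset.mem_Ico.1 i.2).2⟩⟩) ::
      (wordCrossings w).map (Sym2.map (adjSwap i))

/-- A permutation braid: a positive braid in which no pair of strands crosses more than once. -/
def IsPermutationBraid {n : ℕ} (β : BraidGroup n) : Prop :=
  ∃ w : List (BraidGen n),
    β = (w.map fun i => (PresentedGroup.of i : BraidGroup n)).prod ∧ (wordCrossings w).Nodup

/-- The representative in `{1, …, n}` of the residue class of `k * i` modulo `n`. -/
def mulRep (n k : ℕ) (i : BraidPt n) : BraidPt n :=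
  ⟨if k * i.1 % n = 0 then n else k * i.1 % n, by
    have hi := Finset.mem_Icc.1 i.2
    have hlt := Nat.mod_lt (k * i.1) (show 0 < n by omega)
    rw [Finset.mem_Icc]
    split_ifs <;> omega⟩

theorem mulRep_modEq (n k : ℕ) (i : BraidPt n) : (mulRep n k i).1 ≡ k * i.1 [MOD n] := by
  unfold mulRep Nat.ModEq
  dsimp only
  split_ifs with h
  · rw [Nat.mod_self, h]
  · exact Nat.mod_mod _ _

theorem mulRep_bijective {n k : ℕ} (h : n.Coprime k) : Function.Bijective (mulRep n k) := by
  rw [← Finite.injective_iff_bijective]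
  intro i j hij
  have hmod : k * i.1 ≡ k * j.1 [MOD n] :=
    (mulRep_modEq n k i).symm.trans (hij ▸ mulRep_modEq n k j)
  have hmod' : i.1 ≡ j.1 [MOD n] := Nat.ModEq.cancel_left_of_coprime h hmod
  have hi := Finset.mem_Icc.1 i.2
  have hj := Finset.mem_Icc.1 j.2
  apply Subtype.ext
  rcases le_total i.1 j.1 with hle | hle
  · have hd := (Nat.modEq_iff_dvd' hle).1 hmod'
    have := Nat.eq_zero_of_dvd_of_lt hd (by omega)
    omega
  · have hd := (Nat.modEq_iff_dvd' hle).1 hmod'.symm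
    have := Nat.eq_zero_of_dvd_of_lt hd (by omega)
    omega

/-- The `n`-permutation `π_k` with `π_k(i) ≡ k i` modulo `n`, for `k` coprime to `n`. -/
noncomputable def mulPerm {n k : ℕ} (h : n.Coprime k) : Equiv.Perm (BraidPt n) :=
  Equiv.ofBijective (mulRep n k) (mulRep_bijective h)

/-- `a_i = ⌈n i / k⌉`. -/
def ceilIndex (n k i : ℕ) : ℕ := ⌈((n : ℚ) * i / k)⌉₊

/-- `δ U_{a_1} ⋯ U_{a_{k-1}}` in `B_n`, where `a_i = ⌈n i / k⌉`. -/
def deltaUProd (n k : ℕ) : BraidGroup n :=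
  braidDelta n * ((List.range' 1 (k - 1)).map fun i => braidU n (ceilIndex n k i)).prod

/-! A permutation braid is determined by its permutation (Matsumoto's theorem,
`IsReducedLift.unique`), and a product of two permutation braids is again one when no pair that
crosses in the right factor crosses back in the left factor (`IsPermutationBraid.mul`). Identities
between such products therefore reduce to identities of permutations. What remains is the full twist
T on the first k strands.

The braid δ^k is PT with P a permutation braid (`delta_pow_eq`). The points i with π_k(i) ≤ k are
b_m = ⌊nm/k⌋ + 1 for 0 ≤ m < k, that is 1, a_1, …, a_{k-1} (`mulPerm_le_iff`, `ceilIndex_eq`). Let W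
be the permutation braid that joins the right endpoints b_0 < ⋯ < b_{k-1} to the left endpoints 1,
…, k in order, and V its word reversed. Then X = YW with Y preserving {1, …, k}, so Y commutes with
T. Pulling T through W one factor at a time gives TW = V⁻¹ U_{b_0} ⋯ U_{b_{k-1}}
(`fullTwist_mul_shuffle`), and PY = XδV because both sides are permutation braids with the same
permutation. Hence δ^k X = PTYW = (PY)(TW) = Xδ U_{a_1} ⋯ U_{a_{k-1}}, as U_1 = 1. -/

/-! ### Adjacent transpositions and the Artin relations -/

/-- The left end `i` of the pair of endpoints exchanged by `σ_i`. -/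
def genLo {n : ℕ} (p : BraidGen n) : BraidPt n :=
  ⟨p.1, Finset.mem_Icc.2 ⟨(Finset.mem_Ico.1 p.2).1, (Finset.mem_Ico.1 p.2).2.le⟩⟩

/-- The right end `i + 1` of the pair of endpoints exchanged by `σ_i`. -/
def genHi {n : ℕ} (p : BraidGen n) : BraidPt n :=
  ⟨p.1 + 1, Finset.mem_Icc.2 ⟨Nat.succ_pos _, (Finset.mem_Ico.1 p.2).2⟩⟩

theorem adjSwap_eq_swap {n : ℕ} (p : BraidGen n) : adjSwap p = Equiv.swap (genLo p) (genHi p) := rfl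

theorem adjSwap_genLo {n : ℕ} (p : BraidGen n) : adjSwap p (genLo p) = genHi p :=
  Equiv.swap_apply_left _ _

theorem adjSwap_genHi {n : ℕ} (p : BraidGen n) : adjSwap p (genHi p) = genLo p :=
  Equiv.swap_apply_right _ _

theorem adjSwap_adjSwap {n : ℕ} (p : BraidGen n) (x : BraidPt n) :
    adjSwap p (adjSwap p x) = x := by
  rw [← Equiv.Perm.mul_apply, adjSwap_eq_swap, Equiv.swap_mul_self, Equiv.Perm.one_apply]

theorem adjSwap_mul_self {n : ℕ} (p : BraidGen n) : adjSwap p * adjSwap p = 1 :=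
  Equiv.swap_mul_self _ _

theorem inducedPerm_of {n : ℕ} (p : BraidGen n) :
    inducedPerm n (PresentedGroup.of p) = adjSwap p := by
  simp [inducedPerm]

theorem adjSwap_lt {n : ℕ} (p : BraidGen n) {i j : BraidPt n} (hij : i.1 < j.1)
    (hne : ¬ (i = genLo p ∧ j = genHi p)) : (adjSwap p i).1 < (adjSwap p j).1 := by
  have hne' : ¬ (i.1 = p.1 ∧ j.1 = p.1 + 1) := fun h => hne ⟨Subtype.ext h.1, Subtype.ext h.2⟩
  rw [adjSwap_val, adjSwap_val]
  split_ifs <;> omega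

theorem presented_comm {n : ℕ} {p q : BraidGen n} (h : p.1 + 2 ≤ q.1) :
    (PresentedGroup.of p : BraidGroup n) * PresentedGroup.of q =
      PresentedGroup.of q * PresentedGroup.of p := by
  have := PresentedGroup.one_of_mem (rels := braidRels n) (Or.inl ⟨p, q, h, rfl⟩)
  rw [map_mul, map_inv, mul_inv_eq_one, map_mul, map_mul] at this
  exact this

theorem presented_braid {n : ℕ} {p q : BraidGen n} (h : p.1 + 1 = q.1) :
    (PresentedGroup.of p : BraidGroup n) * PresentedGroup.of q * PresentedGroup.of p =
      PresentedGroup.of q * PresentedGroup.of p * PresentedGroup.of q := by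
  have := PresentedGroup.one_of_mem (rels := braidRels n) (Or.inr ⟨p, q, h, rfl⟩)
  rw [map_mul, map_inv, mul_inv_eq_one, map_mul, map_mul, map_mul, map_mul] at this
  exact this

theorem adjSwap_comm {n : ℕ} {p q : BraidGen n} (h : p.1 + 2 ≤ q.1) :
    adjSwap p * adjSwap q = adjSwap q * adjSwap p := by
  simpa [inducedPerm_of] using congrArg (inducedPerm n) (presented_comm h)

theorem adjSwap_braid {n : ℕ} {p q : BraidGen n} (h : p.1 + 1 = q.1) :
    adjSwap p * adjSwap q * adjSwap p = adjSwap q * adjSwap p * adjSwap q := by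
  simpa [inducedPerm_of] using congrArg (inducedPerm n) (presented_braid h)

/-! ### Reduced lifts of permutations and Matsumoto's theorem -/

/-- `IsReducedLift π β` says that `β` is represented by a positive word that is reduced as a word
in the adjacent transpositions, with product `π`. -/
inductive IsReducedLift {n : ℕ} : Equiv.Perm (BraidPt n) → BraidGroup n → Prop
  | one : IsReducedLift 1 1
  | mul_of (π : Equiv.Perm (BraidPt n)) (β : BraidGroup n) (p : BraidGen n) :
      IsReducedLift π β → (π (genLo p)).1 < (π (genHi p)).1 →
      IsReducedLift (π * adjSwap p) (β * PresentedGroup.of p)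

/-- The inversions of a permutation of the endpoints. -/
def inversions {n : ℕ} (π : Equiv.Perm (BraidPt n)) : Finset (BraidPt n × BraidPt n) :=
  Finset.univ.filter fun x => x.1.1 < x.2.1 ∧ (π x.2).1 < (π x.1).1

theorem mem_inversions {n : ℕ} {π : Equiv.Perm (BraidPt n)} {i j : BraidPt n} :
    (i, j) ∈ inversions π ↔ i.1 < j.1 ∧ (π j).1 < (π i).1 := by
  simp [inversions]

/-- Applying `adjSwap p` to both coordinates embeds the inversions of `π * adjSwap p` into those of
`π` and misses the pair at `p` itself. This makes the recursions on reduced words terminate. -/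
theorem card_inversions_lt {n : ℕ} (π : Equiv.Perm (BraidPt n)) (p : BraidGen n)
    (h : (π (genHi p)).1 < (π (genLo p)).1) :
    (inversions (π * adjSwap p)).card < (inversions π).card := by
  rw [← Finset.card_image_of_injective (inversions (π * adjSwap p))
    ((adjSwap p).injective.prodMap (adjSwap p).injective)]
  apply Finset.card_lt_card
  rw [Finset.ssubset_iff_of_subset]
  · refine ⟨(genLo p, genHi p), ?_, ?_⟩
    · exact mem_inversions.2 ⟨Nat.lt_succ_self _, h⟩
    · intro hmem
      obtain ⟨⟨x, y⟩, hx, hxy⟩ := Finset.mem_image.1 hmem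
      replace hx := mem_inversions.1 hx
      simp only [Prod.map_apply, Prod.mk.injEq] at hxy
      have hx' : x = genHi p := by rw [← adjSwap_genLo, ← hxy.1, adjSwap_adjSwap]
      have hy' : y = genLo p := by rw [← adjSwap_genHi, ← hxy.2, adjSwap_adjSwap]
      have := hx.1
      rw [hx', hy'] at this
      simp [genHi, genLo] at this
  · intro z hz
    obtain ⟨⟨x, y⟩, hx, rfl⟩ := Finset.mem_image.1 hz
    replace hx := mem_inversions.1 hx
    simp only [Equiv.Perm.mul_apply] at hx
    refine mem_inversions.2 ⟨adjSwap_lt p hx.1 ?_, hx.2⟩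
    rintro ⟨rfl, rfl⟩
    have := hx.2
    rw [adjSwap_genHi, adjSwap_genLo] at this
    omega

theorem perm_lt_of_forall_ascent {n : ℕ} (π : Equiv.Perm (BraidPt n))
    (h : ∀ p, (π (genLo p)).1 < (π (genHi p)).1) :
    ∀ d (i j : BraidPt n), i.1 + d + 1 = j.1 → (π i).1 < (π j).1 := by
  intro d
  induction d with
  | zero =>
    intro i j hij
    have hi := Finset.mem_Icc.1 i.2
    have hj := Finset.mem_Icc.1 j.2
    have := h ⟨i.1, Finset.mem_Ico.2 (by omega)⟩
    have e : genHi ⟨i.1, Finset.mem_Ico.2 (by omega)⟩ = j := Subtype.ext (by simp [genHi]; omega)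
    rw [e] at this
    exact this
  | succ d ih =>
    intro i j hij
    have hi := Finset.mem_Icc.1 i.2
    have hj := Finset.mem_Icc.1 j.2
    have h1 := ih i ⟨j.1 - 1, Finset.mem_Icc.2 (by omega)⟩ (by simp; omega)
    have := h ⟨j.1 - 1, Finset.mem_Ico.2 (by omega)⟩
    have e : genHi ⟨j.1 - 1, Finset.mem_Ico.2 (by omega)⟩ = j :=
      Subtype.ext (by simp [genHi]; omega)
    rw [e] at this
    exact h1.trans this

theorem eq_one_of_forall_ascent {n : ℕ} (π : Equiv.Perm (BraidPt n))
    (h : ∀ p, (π (genLo p)).1 < (π (genHi p)).1) : π = 1 := by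
  have hm : StrictMono π := fun i j hij => by
    have hij' : i.1 < j.1 := hij
    exact perm_lt_of_forall_ascent π h (j.1 - i.1 - 1) i j (by omega)
  have hm' : StrictMono π.symm := fun i j hij => by
    rw [← hm.lt_iff_lt]; simpa using hij
  ext1 x
  apply le_antisymm
  · have := hm.monotone (hm'.le_apply (x := x))
    simpa using this
  · exact hm.le_apply

theorem genLo_ne_genHi_val {n : ℕ} (π : Equiv.Perm (BraidPt n)) (p : BraidGen n) :
    (π (genLo p)).1 ≠ (π (genHi p)).1 := by
  intro h
  have := congrArg Subtype.val (π.injective (Subtype.ext h))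
  simp [genLo, genHi] at this

theorem exists_descent {n : ℕ} {π : Equiv.Perm (BraidPt n)} (h : π ≠ 1) :
    ∃ p, (π (genHi p)).1 < (π (genLo p)).1 := by
  by_contra hc
  push Not at hc
  exact h (eq_one_of_forall_ascent π fun p => lt_of_le_of_ne (hc p) (genLo_ne_genHi_val π p))

theorem IsReducedLift.of_descent {n : ℕ} {π : Equiv.Perm (BraidPt n)} {β : BraidGroup n}
    {p : BraidGen n} (hβ : IsReducedLift (π * adjSwap p) β)
    (h : (π (genHi p)).1 < (π (genLo p)).1) : IsReducedLift π (β * PresentedGroup.of p) := by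
  have := IsReducedLift.mul_of _ β p hβ (by
    rwa [Equiv.Perm.mul_apply, Equiv.Perm.mul_apply, adjSwap_genLo, adjSwap_genHi])
  rwa [mul_assoc, adjSwap_mul_self, mul_one] at this

theorem exists_isReducedLift {n : ℕ} (π : Equiv.Perm (BraidPt n)) : ∃ β, IsReducedLift π β := by
  by_cases h : π = 1
  · exact ⟨1, h ▸ IsReducedLift.one⟩
  · obtain ⟨p, hp⟩ := exists_descent h
    obtain ⟨β, hβ⟩ := exists_isReducedLift (π * adjSwap p)
    exact ⟨_, hβ.of_descent hp⟩
termination_by (inversions π).card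
decreasing_by exact card_inversions_lt π p hp

theorem IsReducedLift.cases_descent {n : ℕ} {π : Equiv.Perm (BraidPt n)} {β : BraidGroup n}
    (h : IsReducedLift π β) : (π = 1 ∧ β = 1) ∨ ∃ (p : BraidGen n) (γ : BraidGroup n),
      (π (genHi p)).1 < (π (genLo p)).1 ∧ IsReducedLift (π * adjSwap p) γ ∧
        β = γ * PresentedGroup.of p := by
  cases h with
  | one => exact Or.inl ⟨rfl, rfl⟩
  | mul_of π β p hβ hp =>
    refine Or.inr ⟨p, β, ?_, ?_, rfl⟩
    · rwa [Equiv.Perm.mul_apply, Equiv.Perm.mul_apply, adjSwap_genLo, adjSwap_genHi]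
    · rwa [mul_assoc, adjSwap_mul_self, mul_one]

theorem adjSwap_apply_eq_self {n : ℕ} {p : BraidGen n} {x : BraidPt n} (h1 : x.1 ≠ p.1)
    (h2 : x.1 ≠ p.1 + 1) : adjSwap p x = x := by
  apply Subtype.ext
  rw [adjSwap_val, if_neg h1, if_neg h2]

/-- Two distinct descents of a permutation lead to the same lift. -/
theorem diamond {n : ℕ} (π : Equiv.Perm (BraidPt n)) {p q : BraidGen n} (hpq : p.1 < q.1)
    (hp : (π (genHi p)).1 < (π (genLo p)).1) (hq : (π (genHi q)).1 < (π (genLo q)).1) :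
    ∃ β γ : BraidGroup n, IsReducedLift (π * adjSwap p) β ∧ IsReducedLift (π * adjSwap q) γ ∧
      β * PresentedGroup.of p = γ * PresentedGroup.of q := by
  by_cases h2 : p.1 + 2 ≤ q.1
  · obtain ⟨τ, hτ⟩ := exists_isReducedLift (π * adjSwap p * adjSwap q)
    refine ⟨τ * PresentedGroup.of q, τ * PresentedGroup.of p, hτ.of_descent ?_, ?_, ?_⟩
    · simp only [Equiv.Perm.mul_apply]
      rw [adjSwap_apply_eq_self, adjSwap_apply_eq_self]
      · exact hq
      all_goals simp only [genLo, genHi]; omega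
    · rw [mul_assoc, adjSwap_comm h2, ← mul_assoc] at hτ
      apply hτ.of_descent
      simp only [Equiv.Perm.mul_apply]
      rw [adjSwap_apply_eq_self, adjSwap_apply_eq_self]
      · exact hp
      all_goals simp only [genLo, genHi]; omega
    · rw [mul_assoc, mul_assoc, presented_comm h2]
  · have h1 : p.1 + 1 = q.1 := by omega
    have e : genHi p = genLo q := Subtype.ext h1
    have f1 : adjSwap p (genHi q) = genHi q := by
      apply adjSwap_apply_eq_self <;> simp only [genHi] <;> omega
    have f2 : adjSwap q (genLo p) = genLo p := by
      apply adjSwap_apply_eq_self <;> simp only [genLo] <;> omega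
    -- Two neighbouring descents make `π` decreasing on three consecutive points, so three descents
    -- lead down to this permutation along either side of the braid relation.
    obtain ⟨τ, hτ⟩ := exists_isReducedLift (π * (adjSwap p * adjSwap q * adjSwap p))
    have hτ' := hτ
    rw [adjSwap_braid h1] at hτ'
    simp only [← mul_assoc] at hτ hτ'
    refine ⟨τ * PresentedGroup.of p * PresentedGroup.of q,
      τ * PresentedGroup.of q * PresentedGroup.of p, (hτ.of_descent ?_).of_descent ?_,
      (hτ'.of_descent ?_).of_descent ?_, ?_⟩
    · simp only [Equiv.Perm.mul_apply, f2, adjSwap_genLo]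
      rw [e, adjSwap_genLo, f1, ← e]
      exact hq.trans_eq (by rw [← e])
    · simp only [Equiv.Perm.mul_apply, f1]
      rw [← e, adjSwap_genHi]
      rw [← e] at hq
      exact hq.trans hp
    · simp only [Equiv.Perm.mul_apply, f1, adjSwap_genHi]
      rw [← e, adjSwap_genHi, f2]
      exact hp
    · simp only [Equiv.Perm.mul_apply, f2]
      rw [e, adjSwap_genLo]
      rw [← e] at hq
      exact hq.trans hp
    · have := presented_braid h1
      rw [mul_assoc τ, mul_assoc τ, mul_assoc τ, mul_assoc τ, this]

/-- Induction on the number of inversions: if the last letters differ, `diamond` gives two equal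
lifts ending in these letters, and the induction hypothesis identifies the given ones with them. -/
theorem IsReducedLift.unique {n : ℕ} {π : Equiv.Perm (BraidPt n)} {β γ : BraidGroup n}
    (hβ : IsReducedLift π β) (hγ : IsReducedLift π γ) : β = γ := by
  rcases hβ.cases_descent with ⟨h1, rfl⟩ | ⟨p, β', hp, hβ', rfl⟩
  · rcases hγ.cases_descent with ⟨-, rfl⟩ | ⟨q, γ', hq, -, rfl⟩
    · rfl
    · subst h1
      simp [genLo, genHi] at hq
  rcases hγ.cases_descent with ⟨rfl, rfl⟩ | ⟨q, γ', hq, hγ', rfl⟩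
  · simp [genLo, genHi] at hp
  rcases lt_trichotomy p.1 q.1 with h | h | h
  · obtain ⟨τ, τ', h1, h2, h3⟩ := diamond π h hp hq
    rw [hβ'.unique h1, hγ'.unique h2, h3]
  · obtain rfl : p = q := Subtype.ext h
    rw [hβ'.unique hγ']
  · obtain ⟨τ, τ', h1, h2, h3⟩ := diamond π h hq hp
    rw [hβ'.unique h2, hγ'.unique h1, h3]
termination_by (inversions π).card
decreasing_by all_goals first | exact card_inversions_lt π p hp | exact card_inversions_lt π q hq

theorem IsReducedLift.inducedPerm_eq {n : ℕ} {π : Equiv.Perm (BraidPt n)} {β : BraidGroup n}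
    (h : IsReducedLift π β) : inducedPerm n β = π := by
  induction h with
  | one => simp
  | mul_of π β p _ _ ih => rw [map_mul, ih, inducedPerm_of]

/-- By hypothesis a pair that crosses in `γ` does not cross again in `β`, so the letters of `γ` can
be appended one by one, each at an ascent. -/
theorem IsReducedLift.mul {n : ℕ} {π τ : Equiv.Perm (BraidPt n)} {β γ : BraidGroup n}
    (hβ : IsReducedLift π β) (hγ : IsReducedLift τ γ)
    (h : ∀ i j : BraidPt n, i.1 < j.1 → (τ j).1 < (τ i).1 → (π (τ j)).1 < (π (τ i)).1) :
    IsReducedLift (π * τ) (β * γ) := by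
  induction hγ with
  | one => simpa using hβ
  | mul_of τ γ p _ hp ih =>
    rw [← mul_assoc, ← mul_assoc]
    refine IsReducedLift.mul_of _ _ p (ih fun i j hij hτ => ?_) ?_
    · have := h (adjSwap p i) (adjSwap p j) (adjSwap_lt p hij ?_)
      · simp only [Equiv.Perm.mul_apply, adjSwap_adjSwap] at this
        exact this hτ
      · rintro ⟨rfl, rfl⟩
        omega
    · have := h (genLo p) (genHi p) (Nat.lt_succ_self _)
      simp only [Equiv.Perm.mul_apply, adjSwap_genLo, adjSwap_genHi] at this
      exact this hp

/-! ### Permutation braids as reduced lifts -/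

/-- The braid represented by a positive word. -/
abbrev wordBraid {n : ℕ} (w : List (BraidGen n)) : BraidGroup n :=
  (w.map fun i => (PresentedGroup.of i : BraidGroup n)).prod

theorem wordCrossings_concat {n : ℕ} (w : List (BraidGen n)) (p : BraidGen n) :
    wordCrossings (w ++ [p]) = wordCrossings w ++
      [s(inducedPerm n (wordBraid w) (genLo p), inducedPerm n (wordBraid w) (genHi p))] := by
  induction w with
  | nil => simp [wordCrossings, wordBraid, genLo, genHi]
  | cons q w ih =>
    simp only [List.cons_append, wordCrossings, ih, List.map_append, List.map_cons, List.map_nil,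
      Sym2.map_mk, wordBraid, List.prod_cons, map_mul, inducedPerm_of, Equiv.Perm.mul_apply]

/-- While no pair repeats, the recorded pairs are exactly the inverted ones, so a letter that adds a
new pair sits at an ascent. This is why the second claim is carried along with the first. -/
theorem mem_wordCrossings {n : ℕ} (w : List (BraidGen n)) (hw : (wordCrossings w).Nodup) :
    IsReducedLift (inducedPerm n (wordBraid w)) (wordBraid w) ∧
      ∀ i j : BraidPt n, i.1 < j.1 →
        (s(inducedPerm n (wordBraid w) i, inducedPerm n (wordBraid w) j) ∈ wordCrossings w ↔
        (inducedPerm n (wordBraid w) j).1 < (inducedPerm n (wordBraid w) i).1) := by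
  induction w using List.reverseRecOn with
  | nil =>
    refine ⟨by simpa [wordBraid] using IsReducedLift.one, fun i j hij => ?_⟩
    simp [wordCrossings, wordBraid]
    exact hij.le
  | append_singleton w p ih =>
    rw [wordCrossings_concat, List.nodup_append] at hw
    obtain ⟨hw, -, hd⟩ := hw
    obtain ⟨h1, h2⟩ := ih hw
    have hlt : (genLo p).1 < (genHi p).1 := Nat.lt_succ_self _
    have hasc : (inducedPerm n (wordBraid w) (genLo p)).1 <
        (inducedPerm n (wordBraid w) (genHi p)).1 := by
      refine lt_of_le_of_ne (not_lt.1 fun hc => ?_) (genLo_ne_genHi_val _ p)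
      exact hd _ ((h2 _ _ hlt).2 hc) _ (List.mem_singleton_self _) rfl
    have e : wordBraid (w ++ [p]) = wordBraid w * PresentedGroup.of p := by simp [wordBraid]
    refine ⟨?_, fun i j hij => ?_⟩
    · rw [e, map_mul, inducedPerm_of]
      exact IsReducedLift.mul_of _ _ p h1 hasc
    · rw [wordCrossings_concat, e, map_mul, inducedPerm_of]
      simp only [Equiv.Perm.mul_apply, List.mem_append, List.mem_singleton]
      by_cases hc : i = genLo p ∧ j = genHi p
      · obtain ⟨rfl, rfl⟩ := hc
        rw [adjSwap_genLo, adjSwap_genHi]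
        simp [hasc, Sym2.eq_swap]
      · rw [h2 _ _ (adjSwap_lt p hij hc)]
        refine or_iff_left fun hs => ?_
        have hlt' := adjSwap_lt p hij hc
        rcases Sym2.eq_iff.1 hs with ⟨ha, hb⟩ | ⟨ha, hb⟩
        · have ha' := (inducedPerm n (wordBraid w)).injective ha
          have hb' := (inducedPerm n (wordBraid w)).injective hb
          have ha'' : i = genHi p := by rw [← adjSwap_genLo, ← ha', adjSwap_adjSwap]
          have hb'' : j = genLo p := by rw [← adjSwap_genHi, ← hb', adjSwap_adjSwap]
          rw [ha'', hb''] at hij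
          omega
        · rw [(inducedPerm n (wordBraid w)).injective ha,
            (inducedPerm n (wordBraid w)).injective hb] at hlt'
          omega

theorem IsPermutationBraid.isReducedLift {n : ℕ} {β : BraidGroup n} (h : IsPermutationBraid β) :
    IsReducedLift (inducedPerm n β) β := by
  obtain ⟨w, rfl, hw⟩ := h
  exact (mem_wordCrossings w hw).1

theorem IsReducedLift.isPermutationBraid {n : ℕ} {π : Equiv.Perm (BraidPt n)} {β : BraidGroup n}
    (h : IsReducedLift π β) : IsPermutationBraid β := by
  induction h with
  | one => exact ⟨[], rfl, List.nodup_nil⟩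
  | mul_of π β p hβ hp ih =>
    obtain ⟨w, rfl, hw⟩ := ih
    refine ⟨w ++ [p], by simp, ?_⟩
    rw [wordCrossings_concat, List.nodup_append]
    refine ⟨hw, by simp, fun a ha b hb => ?_⟩
    rw [List.mem_singleton.1 hb]
    rintro rfl
    have h2 := ((mem_wordCrossings w hw).2 (genLo p) (genHi p) (Nat.lt_succ_self _)).1 ha
    rw [show inducedPerm n (wordBraid w) = π from hβ.inducedPerm_eq] at h2
    omega

theorem IsPermutationBraid.eq {n : ℕ} {β γ : BraidGroup n} (hβ : IsPermutationBraid β)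
    (hγ : IsPermutationBraid γ) (h : inducedPerm n β = inducedPerm n γ) : β = γ :=
  hβ.isReducedLift.unique (h ▸ hγ.isReducedLift)

theorem exists_isPermutationBraid {n : ℕ} (π : Equiv.Perm (BraidPt n)) :
    ∃ β : BraidGroup n, IsPermutationBraid β ∧ inducedPerm n β = π :=
  let ⟨β, hβ⟩ := exists_isReducedLift π
  ⟨β, hβ.isPermutationBraid, hβ.inducedPerm_eq⟩

theorem IsPermutationBraid.mul {n : ℕ} {β γ : BraidGroup n} (hβ : IsPermutationBraid β)
    (hγ : IsPermutationBraid γ)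
    (h : ∀ i j : BraidPt n, i.1 < j.1 → (inducedPerm n γ j).1 < (inducedPerm n γ i).1 →
      (inducedPerm n β (inducedPerm n γ j)).1 < (inducedPerm n β (inducedPerm n γ i)).1) :
    IsPermutationBraid (β * γ) :=
  (hβ.isReducedLift.mul hγ.isReducedLift h).isPermutationBraid

theorem isPermutationBraid_one {n : ℕ} : IsPermutationBraid (1 : BraidGroup n) :=
  IsReducedLift.one.isPermutationBraid

theorem isPermutationBraid_of {n : ℕ} (p : BraidGen n) :
    IsPermutationBraid (PresentedGroup.of p : BraidGroup n) := by
  have := IsReducedLift.mul_of 1 1 p IsReducedLift.one (Nat.lt_succ_self _)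
  rw [one_mul] at this
  simpa using this.isPermutationBraid

/-- A permutation braid whose permutation preserves `{1, …, k}` commutes with everything that
commutes with all `σ_i`, `i ≠ k`. -/
theorem IsReducedLift.commute {n : ℕ} {π : Equiv.Perm (BraidPt n)} {β : BraidGroup n}
    (h : IsReducedLift π β) {k : ℕ} {z : BraidGroup n}
    (hz : ∀ p : BraidGen n, p.1 ≠ k → Commute z (PresentedGroup.of p))
    (hk : ∀ i, (π i).1 ≤ k ↔ i.1 ≤ k) : Commute z β := by
  induction h with
  | one => exact Commute.one_right z
  | mul_of π β p _ hp ih =>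
    -- If the last letter were σ_k, invariance of {1, …, k} would force `π` to send k + 1 into this
    -- set and k out of it, against the ascent at k.
    have hpk : p.1 ≠ k := by
      intro hpk
      have h1 := hk (genLo p)
      have h2 := hk (genHi p)
      rw [Equiv.Perm.mul_apply, adjSwap_genLo] at h1
      rw [Equiv.Perm.mul_apply, adjSwap_genHi] at h2
      simp only [genLo, genHi] at h1 h2 hp
      omega
    refine (ih fun i => ?_).mul_right (hz p hpk)
    have := hk (adjSwap p i)
    rw [Equiv.Perm.mul_apply, adjSwap_adjSwap, adjSwap_val] at this
    rw [this]
    split_ifs <;> omega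

/-! ### Generators and their monotone products -/

theorem braidSigma_eq {n i : ℕ} (h1 : 1 ≤ i) (hn : i < n) :
    braidSigma n i = PresentedGroup.of ⟨i, Finset.mem_Ico.2 ⟨h1, hn⟩⟩ :=
  dif_pos (Finset.mem_Ico.2 ⟨h1, hn⟩)

theorem braidSigma_val (n : ℕ) (p : BraidGen n) : braidSigma n p.1 = PresentedGroup.of p :=
  dif_pos p.2

theorem braidSigma_commute {n i j : ℕ} (h : i + 2 ≤ j) :
    Commute (braidSigma n i) (braidSigma n j) := by
  by_cases hi : i ∈ Finset.Ico 1 n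
  · by_cases hj : j ∈ Finset.Ico 1 n
    · rw [braidSigma, braidSigma, dif_pos hi, dif_pos hj]
      exact presented_comm (p := ⟨i, hi⟩) (q := ⟨j, hj⟩) h
    · rw [braidSigma, braidSigma, dif_neg hj]
      exact Commute.one_right _
  · rw [braidSigma, dif_neg hi]
    exact Commute.one_left _

theorem braidSigma_braid {n i : ℕ} (h1 : 1 ≤ i) (hn : i + 1 < n) :
    braidSigma n i * braidSigma n (i + 1) * braidSigma n i =
      braidSigma n (i + 1) * braidSigma n i * braidSigma n (i + 1) := by
  rw [braidSigma_eq h1 (by omega), braidSigma_eq (by omega) hn]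
  exact presented_braid rfl

theorem isPermutationBraid_sigma {n i : ℕ} (h1 : 1 ≤ i) (hn : i < n) :
    IsPermutationBraid (braidSigma n i) := by
  rw [braidSigma_eq h1 hn]
  exact isPermutationBraid_of _

theorem inducedPerm_sigma_val {n i : ℕ} (h1 : 1 ≤ i) (hn : i < n) (x : BraidPt n) :
    (inducedPerm n (braidSigma n i) x).1 =
      if x.1 = i then i + 1 else if x.1 = i + 1 then i else x.1 := by
  rw [braidSigma_eq h1 hn, inducedPerm_of, adjSwap_val]

/-- `σ_p σ_{p+1} ⋯ σ_{q-1}` in `B_n`. -/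
def ascProd (n p q : ℕ) : BraidGroup n :=
  ((List.range' p (q - p)).map (braidSigma n)).prod

/-- `σ_{q-1} ⋯ σ_{p+1} σ_p` in `B_n`. -/
def descProd (n p q : ℕ) : BraidGroup n :=
  ((List.range' p (q - p)).reverse.map (braidSigma n)).prod

theorem braidE_eq (n j : ℕ) : braidE n j = ascProd n 1 j := rfl

theorem braidD_eq (n j : ℕ) : braidD n j = descProd n 1 j := rfl

theorem ascProd_self (n p : ℕ) : ascProd n p p = 1 := by simp [ascProd]

theorem descProd_self (n p : ℕ) : descProd n p p = 1 := by simp [descProd]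

theorem ascProd_succ (n : ℕ) {p q : ℕ} (h : p ≤ q) :
    ascProd n p (q + 1) = ascProd n p q * braidSigma n q := by
  rw [ascProd, Nat.succ_sub h, List.range'_concat]
  simp [ascProd, Nat.add_sub_cancel' h]

theorem descProd_succ (n : ℕ) {p q : ℕ} (h : p ≤ q) :
    descProd n p (q + 1) = braidSigma n q * descProd n p q := by
  rw [descProd, Nat.succ_sub h, List.range'_concat]
  simp [descProd, Nat.add_sub_cancel' h]

theorem ascProd_mul (n : ℕ) {p q r : ℕ} (hpq : p ≤ q) (hqr : q ≤ r) :
    ascProd n p q * ascProd n q r = ascProd n p r := by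
  induction r, hqr using Nat.le_induction with
  | base => rw [ascProd_self, mul_one]
  | succ r hr ih => rw [ascProd_succ n hr, ascProd_succ n (hpq.trans hr), ← ih, mul_assoc]

theorem descProd_mul (n : ℕ) {p q r : ℕ} (hpq : p ≤ q) (hqr : q ≤ r) :
    descProd n q r * descProd n p q = descProd n p r := by
  induction r, hqr using Nat.le_induction with
  | base => rw [descProd_self, one_mul]
  | succ r hr ih => rw [descProd_succ n hr, descProd_succ n (hpq.trans hr), ← ih, mul_assoc]

theorem Commute.ascProd {n p q : ℕ} {z : BraidGroup n}
    (h : ∀ i, p ≤ i → i < q → Commute z (braidSigma n i)) : Commute z (ascProd n p q) := by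
  refine Commute.list_prod_right _ _ fun x hx => ?_
  obtain ⟨i, hi, rfl⟩ := List.mem_map.1 hx
  have := List.mem_range'_1.1 hi
  exact h i (by omega) (by omega)

theorem Commute.descProd {n p q : ℕ} {z : BraidGroup n}
    (h : ∀ i, p ≤ i → i < q → Commute z (braidSigma n i)) : Commute z (descProd n p q) := by
  refine Commute.list_prod_right _ _ fun x hx => ?_
  obtain ⟨i, hi, rfl⟩ := List.mem_map.1 hx
  have := List.mem_range'_1.1 (List.mem_reverse.1 hi)
  exact h i (by omega) (by omega)

theorem ascProd_perm_val {n p q : ℕ} (hp : 1 ≤ p) (hpq : p ≤ q) (hq : q ≤ n) (x : BraidPt n) :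
    (inducedPerm n (ascProd n p q) x).1 =
      if x.1 = q then p else if p ≤ x.1 ∧ x.1 < q then x.1 + 1 else x.1 := by
  induction q, hpq using Nat.le_induction generalizing x with
  | base =>
    rw [ascProd_self, map_one, Equiv.Perm.one_apply]
    split_ifs <;> omega
  | succ q hpq ih =>
    rw [ascProd_succ n hpq, map_mul, Equiv.Perm.mul_apply, ih (by omega),
      inducedPerm_sigma_val (by omega) (by omega)]
    split_ifs <;> omega

theorem descProd_perm_val {n p q : ℕ} (hp : 1 ≤ p) (hpq : p ≤ q) (hq : q ≤ n) (x : BraidPt n) :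
    (inducedPerm n (descProd n p q) x).1 =
      if x.1 = p then q else if p < x.1 ∧ x.1 ≤ q then x.1 - 1 else x.1 := by
  induction q, hpq using Nat.le_induction generalizing x with
  | base =>
    rw [descProd_self, map_one, Equiv.Perm.one_apply]
    split_ifs <;> omega
  | succ q hpq ih =>
    rw [descProd_succ n hpq, map_mul, Equiv.Perm.mul_apply,
      inducedPerm_sigma_val (by omega) (by omega), ih (by omega)]
    split_ifs <;> omega

theorem isPermutationBraid_ascProd {n p q : ℕ} (hp : 1 ≤ p) (hpq : p ≤ q) (hq : q ≤ n) :
    IsPermutationBraid (ascProd n p q) := by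
  induction q, hpq using Nat.le_induction with
  | base => rw [ascProd_self]; exact isPermutationBraid_one
  | succ q hpq ih =>
    rw [ascProd_succ n hpq]
    refine (ih (by omega)).mul (isPermutationBraid_sigma (by omega) (by omega)) ?_
    intro i j hij h
    rw [ascProd_perm_val hp hpq (by omega), ascProd_perm_val hp hpq (by omega)]
    rw [inducedPerm_sigma_val (by omega) (by omega),
      inducedPerm_sigma_val (by omega) (by omega)] at h ⊢
    split_ifs at h ⊢ <;> omega

theorem isPermutationBraid_descProd {n p q : ℕ} (hp : 1 ≤ p) (hpq : p ≤ q) (hq : q ≤ n) :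
    IsPermutationBraid (descProd n p q) := by
  induction q, hpq using Nat.le_induction with
  | base => rw [descProd_self]; exact isPermutationBraid_one
  | succ q hpq ih =>
    rw [descProd_succ n hpq]
    refine (isPermutationBraid_sigma (by omega) (by omega)).mul (ih (by omega)) ?_
    intro i j hij h
    rw [inducedPerm_sigma_val (by omega) (by omega), inducedPerm_sigma_val (by omega) (by omega)]
    rw [descProd_perm_val hp hpq (by omega), descProd_perm_val hp hpq (by omega)] at h ⊢
    split_ifs at h ⊢ <;> omega

theorem descProd_perm_eq_inv {n p q : ℕ} (hp : 1 ≤ p) (hpq : p ≤ q) (hq : q ≤ n) :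
    inducedPerm n (descProd n p q) = (inducedPerm n (ascProd n p q))⁻¹ := by
  rw [eq_inv_iff_mul_eq_one]
  ext x
  rw [Equiv.Perm.mul_apply, descProd_perm_val hp hpq hq, ascProd_perm_val hp hpq hq,
    Equiv.Perm.one_apply]
  split_ifs <;> omega

/-! ### The braids U_j and the full twist -/

theorem braidE_mul_sigma {n i j : ℕ} (h1 : 1 ≤ i) (hij : i + 1 < j) (hj : j ≤ n) :
    braidE n j * braidSigma n i = braidSigma n (i + 1) * braidE n j := by
  have e : braidE n j = braidE n i * (braidSigma n i * braidSigma n (i + 1)) *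
      ascProd n (i + 2) j := by
    rw [braidE_eq, braidE_eq, ← mul_assoc, ← ascProd_succ n h1, ← ascProd_succ n (by omega),
      ascProd_mul n (by omega) (by omega)]
  have c1 : Commute (braidSigma n i) (ascProd n (i + 2) j) :=
    Commute.ascProd fun l hl _ => braidSigma_commute hl
  have c2 : Commute (braidSigma n (i + 1)) (braidE n i) :=
    Commute.ascProd fun l _ hl => (braidSigma_commute (by omega)).symm
  rw [e, mul_assoc, ← c1.eq, ← mul_assoc, mul_assoc (braidE n i), braidSigma_braid h1 (by omega),
    ← mul_assoc, ← mul_assoc, ← mul_assoc, ← c2.eq]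
  simp only [mul_assoc]

theorem braidD_mul_sigma {n i j : ℕ} (h1 : 1 ≤ i) (hij : i + 1 < j) (hj : j ≤ n) :
    braidD n j * braidSigma n (i + 1) = braidSigma n i * braidD n j := by
  have e : braidD n j = descProd n (i + 2) j * (braidSigma n (i + 1) * braidSigma n i) *
      braidD n i := by
    rw [braidD_eq, braidD_eq, mul_assoc, mul_assoc, ← descProd_succ n h1,
      ← descProd_succ n (by omega), descProd_mul n (by omega) (by omega)]
  have c1 : Commute (braidSigma n i) (descProd n (i + 2) j) :=
    Commute.descProd fun l hl _ => braidSigma_commute hl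
  have c2 : Commute (braidSigma n (i + 1)) (braidD n i) :=
    Commute.descProd fun l _ hl => (braidSigma_commute (by omega)).symm
  rw [e, mul_assoc, ← c2.eq, ← mul_assoc, mul_assoc (descProd _ _ _),
    ← braidSigma_braid h1 (by omega), ← mul_assoc, ← mul_assoc, ← mul_assoc, ← mul_assoc, ← c1.eq]
  simp only [mul_assoc]

/-- For i + 1 < j, moving σ_i leftwards through E_j raises its index by one and moving it on through
D_j lowers it again. For i > j all letters are far from σ_i. -/
theorem braidU_commute_sigma {n i j : ℕ} (hj : j ≤ n) (h : j < i ∨ (1 ≤ i ∧ i + 1 < j)) :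
    Commute (braidU n j) (braidSigma n i) := by
  rcases h with h | ⟨h1, h⟩
  · have c1 : Commute (braidSigma n i) (braidD n j) :=
      Commute.descProd fun l _ hl => (braidSigma_commute (by omega)).symm
    have c2 : Commute (braidSigma n i) (braidE n j) :=
      Commute.ascProd fun l _ hl => (braidSigma_commute (by omega)).symm
    exact (c1.mul_right c2).symm
  · rw [Commute, SemiconjBy, braidU, mul_assoc, braidE_mul_sigma h1 h hj, ← mul_assoc,
      braidD_mul_sigma h1 h hj, mul_assoc]

theorem braidU_commute {n i j : ℕ} (hij : i < j) (hj : j ≤ n) :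
    Commute (braidU n j) (braidU n i) :=
  (Commute.descProd fun _ h1 hl => braidU_commute_sigma hj (Or.inr (by omega))).mul_right
    (Commute.ascProd fun _ h1 hl => braidU_commute_sigma hj (Or.inr (by omega)))

theorem braidU_conj {n p q : ℕ} (hp : 1 ≤ p) (hpq : p ≤ q) :
    descProd n p q * braidU n p * ascProd n p q = braidU n q := by
  rw [braidU, braidU, braidD_eq, braidE_eq, braidD_eq, braidE_eq, ← mul_assoc,
    descProd_mul n hp hpq, mul_assoc, ascProd_mul n hp hpq]

theorem braidU_succ {n j : ℕ} (hj : 1 ≤ j) :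
    braidU n (j + 1) = braidSigma n j * braidU n j * braidSigma n j := by
  rw [← braidU_conj hj (Nat.le_succ j), descProd_succ n le_rfl, ascProd_succ n le_rfl,
    descProd_self, ascProd_self, mul_one, one_mul]

theorem braidU_one (n : ℕ) : braidU n 1 = 1 := by
  rw [braidU, braidD_eq, braidE_eq, descProd_self, ascProd_self, one_mul]

/-- `U_k ⋯ U_2 U_1`, the full twist on the first `k` strands. -/
def fullTwist (n : ℕ) : ℕ → BraidGroup n
  | 0 => 1
  | k + 1 => braidU n (k + 1) * fullTwist n k

theorem braidU_commute_fullTwist {n k j : ℕ} (hkj : k < j) (hj : j ≤ n) :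
    Commute (braidU n j) (fullTwist n k) := by
  induction k with
  | zero => exact Commute.one_right _
  | succ k ih => exact (braidU_commute hkj hj).mul_right (ih (by omega))

theorem fullTwist_commute_sigma_of_lt {n k i : ℕ} (hk : k ≤ n) (hik : k < i) :
    Commute (fullTwist n k) (braidSigma n i) := by
  induction k with
  | zero => exact Commute.one_left _
  | succ k ih =>
    exact (braidU_commute_sigma hk (Or.inl hik)).mul_left (ih (by omega) (by omega))

theorem fullTwist_commute_sigma {n k i : ℕ} (hk : k ≤ n) (h1 : 1 ≤ i) (hik : i ≠ k) :
    Commute (fullTwist n k) (braidSigma n i) := by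
  induction k with
  | zero => exact Commute.one_left _
  | succ k ih =>
    by_cases hi : i = k
    · subst hi
      obtain ⟨m, rfl⟩ : ∃ m, i = m + 1 := ⟨i - 1, by omega⟩
      have c1 := (braidU_commute (n := n) (Nat.lt_succ_self (m + 1)) hk).symm.eq
      rw [braidU_succ h1] at c1
      rw [fullTwist, fullTwist, ← mul_assoc]
      refine Commute.mul_left ?_ (fullTwist_commute_sigma_of_lt (by omega) (Nat.lt_succ_self m))
      rw [Commute, SemiconjBy, braidU_succ h1]
      simp only [mul_assoc] at c1 ⊢
      rw [c1]
    · exact (braidU_commute_sigma hk (by omega)).mul_left (ih (by omega) hi)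

/-! ### Powers of δ as a permutation braid times a full twist -/

theorem delta_pow_perm_val {n j : ℕ} (hj : j ≤ n) (x : BraidPt n) :
    (inducedPerm n (braidDelta n ^ j) x).1 = if x.1 ≤ j then x.1 + n - j else x.1 - j := by
  have hx := Finset.mem_Icc.1 x.2
  induction j with
  | zero => rw [pow_zero, map_one, Equiv.Perm.one_apply]; split_ifs <;> omega
  | succ j ih =>
    rw [pow_succ', map_mul, Equiv.Perm.mul_apply, braidDelta, braidD_eq,
      descProd_perm_val le_rfl (by omega) le_rfl]
    rw [braidDelta, braidD_eq] at ih
    rw [ih (by omega)]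
    split_ifs <;> omega

/-- In P the strand at the right endpoint j + 1 starts at 1, so P = Q E_{j+1} with the permutation
of Q fixing 1. Prefixing δ moves this start to n, and δQ = P' D_{j+1}; the factors D_{j+1} and
E_{j+1} then meet to form U_{j+1}. -/
theorem delta_mul_permBraid {n j : ℕ} (hj : j < n) {P P' : BraidGroup n}
    (hP : IsPermutationBraid P) (hP' : IsPermutationBraid P')
    (eP : inducedPerm n P = inducedPerm n (braidDelta n ^ j))
    (eP' : inducedPerm n P' = inducedPerm n (braidDelta n ^ (j + 1))) :
    braidDelta n * P = P' * braidU n (j + 1) := by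
  obtain ⟨Q, hQ, eQ⟩ := exists_isPermutationBraid
    (inducedPerm n (braidDelta n ^ j) * inducedPerm n (braidD n (j + 1)))
  have vQ : ∀ x, (inducedPerm n Q x).1 =
      if x.1 = 1 then 1 else if x.1 ≤ j + 1 then x.1 - 1 + n - j else x.1 - j := by
    intro x
    have hx := Finset.mem_Icc.1 x.2
    rw [eQ, Equiv.Perm.mul_apply, delta_pow_perm_val hj.le, braidD_eq,
      descProd_perm_val le_rfl (by omega) hj]
    split_ifs <;> omega
  have hE : IsPermutationBraid (braidE n (j + 1)) :=
    isPermutationBraid_ascProd le_rfl (by omega) hj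
  have hD : IsPermutationBraid (braidD n (j + 1)) :=
    isPermutationBraid_descProd le_rfl (by omega) hj
  have h1 : P = Q * braidE n (j + 1) := by
    refine hP.eq (hQ.mul hE fun x y hxy h => ?_) ?_
    · have hx := Finset.mem_Icc.1 x.2
      have hy := Finset.mem_Icc.1 y.2
      rw [vQ, vQ]
      rw [braidE_eq, ascProd_perm_val le_rfl (by omega) hj,
        ascProd_perm_val le_rfl (by omega) hj] at h ⊢
      split_ifs at h ⊢ <;> omega
    · rw [map_mul, eP, eQ, braidD_eq, braidE_eq, descProd_perm_eq_inv le_rfl (by omega) hj,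
        inv_mul_cancel_right]
  have h2 : braidDelta n * Q = P' * braidD n (j + 1) := by
    refine ((isPermutationBraid_descProd le_rfl (by omega) le_rfl).mul hQ fun x y hxy h => ?_).eq
      (hP'.mul hD fun x y hxy h => ?_) ?_
    · have hx := Finset.mem_Icc.1 x.2
      have hy := Finset.mem_Icc.1 y.2
      rw [descProd_perm_val le_rfl (by omega) le_rfl, descProd_perm_val le_rfl (by omega) le_rfl]
      rw [vQ, vQ] at h ⊢
      split_ifs at h ⊢ <;> omega
    · have hx := Finset.mem_Icc.1 x.2
      have hy := Finset.mem_Icc.1 y.2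
      have hd : (inducedPerm n (braidD n (j + 1)) x).1 ≤ j + 1 ∧
          (inducedPerm n (braidD n (j + 1)) y).1 ≤ j + 1 := by
        rw [braidD_eq, descProd_perm_val le_rfl (by omega) hj,
          descProd_perm_val le_rfl (by omega) hj] at h ⊢
        split_ifs at h ⊢ <;> omega
      rw [eP', delta_pow_perm_val hj, delta_pow_perm_val hj, if_pos hd.1, if_pos hd.2]
      omega
    · rw [map_mul, map_mul, eQ, eP', pow_succ', map_mul, mul_assoc]
      rfl
  rw [h1, ← mul_assoc, h2, braidU, mul_assoc]

theorem delta_pow_eq {n j : ℕ} (hj : j ≤ n) {P : BraidGroup n} (hP : IsPermutationBraid P)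
    (eP : inducedPerm n P = inducedPerm n (braidDelta n ^ j)) :
    braidDelta n ^ j = P * fullTwist n j := by
  induction j generalizing P with
  | zero =>
    rw [fullTwist, pow_zero, mul_one]
    exact isPermutationBraid_one.eq hP (by rw [eP, pow_zero])
  | succ j ih =>
    obtain ⟨Q, hQ, eQ⟩ := exists_isPermutationBraid (inducedPerm n (braidDelta n ^ j))
    rw [pow_succ', ih (by omega) hQ eQ, ← mul_assoc, delta_mul_permBraid hj hQ hP eQ eP,
      fullTwist, mul_assoc]

/-! ### Pulling the full twist through a shuffle -/

/-- The braid moving the strands at the right endpoints `b 0 < ⋯ < b (m - 1)` to the left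
endpoints `1, …, m`, with crossings of the same sign. -/
def shuffle (n : ℕ) (b : ℕ → ℕ) : ℕ → BraidGroup n
  | 0 => 1
  | m + 1 => ascProd n (m + 1) (b m) * shuffle n b m

/-- The positive word of `shuffle` read backwards. -/
def revShuffle (n : ℕ) (b : ℕ → ℕ) : ℕ → BraidGroup n
  | 0 => 1
  | m + 1 => revShuffle n b m * descProd n (m + 1) (b m)

/-- `U_{b 0} ⋯ U_{b (m - 1)}`. -/
def prodU (n : ℕ) (b : ℕ → ℕ) : ℕ → BraidGroup n
  | 0 => 1
  | m + 1 => prodU n b m * braidU n (b m)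

section Shuffle

variable {n k : ℕ} {b : ℕ → ℕ}

theorem braidU_commute_shuffle (hb : ∀ l m, l < m → m < k → b l < b m) (hn : ∀ m < k, b m ≤ n)
    {m : ℕ} (hm : m < k) : ∀ l ≤ m, Commute (braidU n (b m)) (shuffle n b l) := by
  intro l hl
  induction l with
  | zero => exact Commute.one_right _
  | succ l ih =>
    have := hb l m hl hm
    exact (Commute.ascProd fun i h1 h2 => braidU_commute_sigma (hn m hm)
      (Or.inr (by omega))).mul_right (ih (by omega))

/-- By `braidU_conj`, U_{m+1} passes the new ascending factor to become U_{b m}, leaving the inverse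
of the descending factor. That inverse commutes with the smaller full twist, and U_{b m} commutes
with the remaining shuffle. -/
theorem fullTwist_mul_shuffle (hb : ∀ l m, l < m → m < k → b l < b m) (hn : ∀ m < k, b m ≤ n)
    (hlow : ∀ m < k, m + 1 ≤ b m) {m : ℕ} (hm : m ≤ k) :
    fullTwist n m * shuffle n b m = (revShuffle n b m)⁻¹ * prodU n b m := by
  induction m with
  | zero => simp [fullTwist, shuffle, revShuffle, prodU]
  | succ m ih =>
    have hmn : b m ≤ n := hn m hm
    have hml : m + 1 ≤ b m := hlow m hm
    have c1 := (braidU_commute_fullTwist (n := n) (Nat.lt_succ_self m) (by omega)).eq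
    have c2 := (braidU_commute_shuffle hb hn hm m le_rfl).eq
    have c3 : Commute (fullTwist n m) (descProd n (m + 1) (b m)) :=
      Commute.descProd fun i h1 _ => fullTwist_commute_sigma_of_lt (by omega) h1
    have c := braidU_conj (n := n) (Nat.succ_le_succ (Nat.zero_le m)) hml
    rw [mul_assoc, ← eq_inv_mul_iff_mul_eq] at c
    calc fullTwist n (m + 1) * shuffle n b (m + 1)
        = fullTwist n m * (braidU n (m + 1) * ascProd n (m + 1) (b m)) * shuffle n b m := by
          rw [fullTwist, shuffle, c1]; simp only [mul_assoc]
      _ = (descProd n (m + 1) (b m))⁻¹ * (fullTwist n m * shuffle n b m) * braidU n (b m) := by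
          rw [c, ← mul_assoc, c3.inv_right.eq]
          simp only [mul_assoc]
          rw [c2]
      _ = _ := by
          rw [ih (by omega), revShuffle, prodU]; group

theorem shuffle_perm_fix (hn : ∀ m < k, b m ≤ n) (hlow : ∀ m < k, m + 1 ≤ b m) {m : ℕ} (hm : m ≤ k) (x : BraidPt n)
    (hx : ∀ l < m, b l < x.1) : (inducedPerm n (shuffle n b m) x).1 = x.1 := by
  induction m with
  | zero => simp [shuffle]
  | succ m ih =>
    have := hx m (Nat.lt_succ_self m)
    rw [shuffle, map_mul, Equiv.Perm.mul_apply,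
      ascProd_perm_val (by omega) (hlow m hm) (hn m hm), ih (by omega) fun l hl => hx l (by omega)]
    split_ifs <;> omega

/-- All points from `b m` on are fixed, so by injectivity the points below `b m` are permuted among
themselves. -/
theorem shuffle_perm_le (hb : ∀ l m, l < m → m < k → b l < b m) (hn : ∀ m < k, b m ≤ n)
    (hlow : ∀ m < k, m + 1 ≤ b m) {m : ℕ} (hm : m < k) (x : BraidPt n) :
    (x.1 < b m ↔ (inducedPerm n (shuffle n b m) x).1 < b m) ∧
    (x.1 = b m ↔ (inducedPerm n (shuffle n b m) x).1 = b m) := by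
  have key : ∀ y : BraidPt n, b m ≤ y.1 → (inducedPerm n (shuffle n b m) y).1 = y.1 := fun y hy =>
    shuffle_perm_fix hn hlow hm.le y fun l hl => (hb l m hl hm).trans_le hy
  by_cases hx : b m ≤ x.1
  · rw [key x hx]; exact ⟨Iff.rfl, Iff.rfl⟩
  · have h2 : (inducedPerm n (shuffle n b m) x).1 < b m := by
      by_contra hc
      have := key _ (not_lt.1 hc)
      have := (inducedPerm n (shuffle n b m)).injective (Subtype.ext this)
      rw [this] at hc
      omega
    omega

theorem shuffle_perm_mem (hb : ∀ l m, l < m → m < k → b l < b m) (hn : ∀ m < k, b m ≤ n)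
    (hlow : ∀ m < k, m + 1 ≤ b m) {m : ℕ} (hm : m ≤ k) (x : BraidPt n) :
    (inducedPerm n (shuffle n b m) x).1 ≤ m ↔ ∃ l < m, x.1 = b l := by
  induction m with
  | zero =>
    have := (Finset.mem_Icc.1 (inducedPerm n (shuffle n b 0) x).2).1
    simp; omega
  | succ m ih =>
    have hx := shuffle_perm_le hb hn hlow hm x
    have hlm := hlow m hm
    have ih' := ih (by omega)
    rw [shuffle, map_mul, Equiv.Perm.mul_apply, ascProd_perm_val (by omega) hlm (hn m hm)]
    constructor
    · intro h
      by_cases hxb : x.1 = b m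
      · exact ⟨m, Nat.lt_succ_self m, hxb⟩
      · obtain ⟨l, hl, e⟩ := ih'.1 (by split_ifs at h <;> omega)
        exact ⟨l, by omega, e⟩
    · rintro ⟨l, hl, e⟩
      rcases Nat.lt_succ_iff_lt_or_eq.1 hl with hl | rfl
      · have := ih'.2 ⟨l, hl, e⟩
        split_ifs <;> omega
      · rw [if_pos (hx.2.1 e)]

/-- Only a selected and an unselected strand ever cross, since both classes keep their internal
order. The crossing checks for X = YW and for XδV rest on this. -/
theorem shuffle_perm_inversion (hb : ∀ l m, l < m → m < k → b l < b m) (hn : ∀ m < k, b m ≤ n)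
    (hlow : ∀ m < k, m + 1 ≤ b m) {m : ℕ} (hm : m ≤ k) (x y : BraidPt n) (hxy : x.1 < y.1)
    (h : (inducedPerm n (shuffle n b m) y).1 < (inducedPerm n (shuffle n b m) x).1) :
    (inducedPerm n (shuffle n b m) y).1 ≤ m ∧ m < (inducedPerm n (shuffle n b m) x).1 := by
  induction m with
  | zero => rw [shuffle, map_one, Equiv.Perm.one_apply, Equiv.Perm.one_apply] at h; omega
  | succ m ih =>
    have hx := shuffle_perm_le hb hn hlow hm x
    have hy := shuffle_perm_le hb hn hlow hm y
    have hlm := hlow m hm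
    have ih' := ih (by omega)
    rw [shuffle, map_mul, Equiv.Perm.mul_apply, Equiv.Perm.mul_apply,
      ascProd_perm_val (by omega) hlm (hn m hm), ascProd_perm_val (by omega) hlm (hn m hm)] at h ⊢
    have hne : (inducedPerm n (shuffle n b m) y).1 ≠ (inducedPerm n (shuffle n b m) x).1 := by
      intro e
      have := congrArg Subtype.val ((inducedPerm n (shuffle n b m)).injective (Subtype.ext e))
      omega
    split_ifs at h ⊢ <;> omega

theorem isPermutationBraid_shuffle (hb : ∀ l m, l < m → m < k → b l < b m)
    (hn : ∀ m < k, b m ≤ n) (hlow : ∀ m < k, m + 1 ≤ b m) {m : ℕ} (hm : m ≤ k) :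
    IsPermutationBraid (shuffle n b m) := by
  induction m with
  | zero => exact isPermutationBraid_one
  | succ m ih =>
    have hlm := hlow m hm
    refine (isPermutationBraid_ascProd (by omega) hlm (hn m hm)).mul (ih (by omega)) ?_
    intro x y hxy h
    have hx := shuffle_perm_le hb hn hlow hm x
    have hy := shuffle_perm_le hb hn hlow hm y
    rw [ascProd_perm_val (by omega) hlm (hn m hm), ascProd_perm_val (by omega) hlm (hn m hm)]
    split_ifs <;> omega

theorem revShuffle_perm (hn : ∀ m < k, b m ≤ n)
    (hlow : ∀ m < k, m + 1 ≤ b m) {m : ℕ} (hm : m ≤ k) :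
    inducedPerm n (revShuffle n b m) = (inducedPerm n (shuffle n b m))⁻¹ := by
  induction m with
  | zero => simp [shuffle, revShuffle]
  | succ m ih =>
    rw [shuffle, revShuffle, map_mul, map_mul, ih (by omega), mul_inv_rev,
      descProd_perm_eq_inv (by omega) (hlow m hm) (hn m hm)]

/-- In the last factor only the strand joining the right endpoint m + 1 to `b m` crosses others. The
earlier factors fix `b m` and keep smaller points below it, so none of these crossings is undone. -/
theorem isPermutationBraid_revShuffle (hb : ∀ l m, l < m → m < k → b l < b m)
    (hn : ∀ m < k, b m ≤ n) (hlow : ∀ m < k, m + 1 ≤ b m) {m : ℕ} (hm : m ≤ k) :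
    IsPermutationBraid (revShuffle n b m) := by
  induction m with
  | zero => exact isPermutationBraid_one
  | succ m ih =>
    have hlm := hlow m hm
    refine (ih (by omega)).mul (isPermutationBraid_descProd (by omega) hlm (hn m hm)) ?_
    intro i j hij h
    rw [revShuffle_perm hn hlow (by omega), Equiv.Perm.inv_def]
    have hx := shuffle_perm_le hb hn hlow hm
      ((inducedPerm n (shuffle n b m)).symm (inducedPerm n (descProd n (m + 1) (b m)) i))
    have hy := shuffle_perm_le hb hn hlow hm
      ((inducedPerm n (shuffle n b m)).symm (inducedPerm n (descProd n (m + 1) (b m)) j))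
    rw [Equiv.apply_symm_apply] at hx hy
    rw [descProd_perm_val (by omega) hlm (hn m hm)] at h hx hy
    rw [descProd_perm_val (by omega) hlm (hn m hm)] at h
    split_ifs at h hx hy <;> omega

end Shuffle

/-! ### Arithmetic of multiplication by k modulo n -/

theorem mulPerm_val {n k : ℕ} (h : n.Coprime k) (hk : 0 < k) (i : BraidPt n) :
    ∃ q, k * i.1 = n * q + (mulPerm h i).1 := by
  have hi := Finset.mem_Icc.1 i.2
  have hle : (mulPerm h i).1 ≤ k * i.1 := by
    change (mulRep n k i).1 ≤ _
    unfold mulRep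
    dsimp only
    split_ifs with h0
    · exact Nat.le_of_dvd (Nat.mul_pos hk hi.1) (Nat.dvd_of_mod_eq_zero h0)
    · exact Nat.mod_le _ _
  obtain ⟨q, hq⟩ := (Nat.modEq_iff_dvd' hle).1 (mulRep_modEq n k i)
  exact ⟨q, by omega⟩

theorem eq_of_modEq_of_mem {n : ℕ} {x y : BraidPt n} (h : x.1 ≡ y.1 [MOD n]) : x = y := by
  have hx := Finset.mem_Icc.1 x.2
  have hy := Finset.mem_Icc.1 y.2
  apply Subtype.ext
  rcases le_total x.1 y.1 with hle | hle
  · have := Nat.eq_zero_of_dvd_of_lt ((Nat.modEq_iff_dvd' hle).1 h) (by omega)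
    omega
  · have := Nat.eq_zero_of_dvd_of_lt ((Nat.modEq_iff_dvd' hle).1 h.symm) (by omega)
    omega

/-- `⌊n m / k⌋ + 1`. -/
def strandIndex (n k m : ℕ) : ℕ := n * m / k + 1

/-- Coprimality keeps nm/k from being an integer when 0 < m < k. The case m = 0 is excluded: there
the ceiling is 0, while `strandIndex` is 1. -/
theorem ceilIndex_eq {n k m : ℕ} (hcop : n.Coprime k) (hm : 1 ≤ m) (hmk : m < k) :
    ceilIndex n k m = strandIndex n k m := by
  have hk : (0 : ℚ) < k := by exact_mod_cast (by omega : 0 < k)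
  rw [ceilIndex, strandIndex, Nat.ceil_eq_iff (Nat.succ_ne_zero _), Nat.succ_sub_one,
    lt_div_iff₀ hk, div_le_iff₀ hk]
  have hmod := Nat.div_add_mod (n * m) k
  have hlt := Nat.mod_lt (n * m) (show 0 < k by omega)
  have hne : n * m % k ≠ 0 := fun h0 => by
    have := hcop.symm.dvd_of_dvd_mul_left (Nat.dvd_of_mod_eq_zero h0)
    have := Nat.le_of_dvd (by omega) this
    omega
  constructor
  · exact_mod_cast (by rw [mul_comm _ k]; omega : n * m / k * k < n * m)
  · exact_mod_cast (by rw [Nat.succ_mul, mul_comm _ k]; omega : n * m ≤ (n * m / k).succ * k)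

theorem strandIndex_lt {n k : ℕ} (hk : 0 < k) (hkn : k ≤ n) {l m : ℕ} (h : l < m) :
    strandIndex n k l < strandIndex n k m := by
  have h1 : n * l + k ≤ n * m :=
    (by rw [mul_add, mul_one]; omega : n * l + k ≤ n * (l + 1)).trans (Nat.mul_le_mul_left n h)
  have h2 := Nat.div_le_div_right (c := k) h1
  rw [Nat.add_div_right _ hk] at h2
  exact Nat.succ_lt_succ (Nat.lt_of_succ_le h2)

theorem strandIndex_ge {n k : ℕ} (hk : 0 < k) (hkn : k ≤ n) (m : ℕ) :
    m + 1 ≤ strandIndex n k m := by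
  induction m with
  | zero => simp [strandIndex]
  | succ m ih => exact Nat.succ_le_of_lt (ih.trans_lt (strandIndex_lt hk hkn (Nat.lt_succ_self m)))

theorem strandIndex_le {n k m : ℕ} (hn : 0 < n) (h : m < k) : strandIndex n k m ≤ n :=
  Nat.succ_le_of_lt ((Nat.div_lt_iff_lt_mul (by omega)).2 (Nat.mul_lt_mul_of_pos_left h hn))

/-- Write ki = nq + π_k(i). Then π_k(i) ≤ k exactly when i is the first point with ki > nq, which is
⌊nq/k⌋ + 1. -/
theorem mulPerm_le_iff {n k : ℕ} (hcop : n.Coprime k) (hk : 0 < k) (hkn : k ≤ n) (i : BraidPt n) :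
    (mulPerm hcop i).1 ≤ k ↔ ∃ m < k, i.1 = strandIndex n k m := by
  have hi := Finset.mem_Icc.1 i.2
  have hr := Finset.mem_Icc.1 (mulPerm hcop i).2
  obtain ⟨q, hq⟩ := mulPerm_val hcop hk i
  have hqk : q < k := by
    by_contra hc
    have h1 := Nat.mul_le_mul_left n (not_lt.1 hc)
    have h2 := Nat.mul_le_mul_left k hi.2
    rw [mul_comm k n] at h2
    omega
  constructor
  · intro h
    refine ⟨q, hqk, ?_⟩
    have : n * q / k = i.1 - 1 := by
      rw [Nat.div_eq_iff hk]
      obtain ⟨j, hj⟩ : ∃ j, i.1 = j + 1 := ⟨i.1 - 1, by omega⟩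
      rw [hj] at hq ⊢
      rw [Nat.add_sub_cancel, mul_comm j]
      rw [mul_add] at hq
      omega
    rw [strandIndex, this]
    omega
  · rintro ⟨m, hm, e⟩
    have h1 := Nat.div_add_mod (n * m) k
    have h2 := Nat.mod_lt (n * m) hk
    rw [e, strandIndex, mul_add, mul_one] at hq
    have hmq : m = q := by
      rcases lt_trichotomy m q with h | h | h
      · have := Nat.mul_le_mul_left n (Nat.succ_le_of_lt h)
        rw [Nat.succ_eq_add_one, mul_add, mul_one] at this
        omega
      · exact h
      · have := Nat.mul_le_mul_left n (Nat.succ_le_of_lt h)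
        rw [Nat.succ_eq_add_one, mul_add, mul_one] at this
        omega
    subst hmq
    omega

theorem delta_perm_val {n : ℕ} (x : BraidPt n) :
    (inducedPerm n (braidDelta n) x).1 = if x.1 = 1 then n else x.1 - 1 := by
  have hx := Finset.mem_Icc.1 x.2
  rw [braidDelta, braidD_eq, descProd_perm_val le_rfl (by omega) le_rfl]
  split_ifs <;> omega

/-- Both sides send x to the representative of kx − k modulo n. -/
theorem mulPerm_mul_delta {n k : ℕ} (hcop : n.Coprime k) (hkn : k ≤ n) :
    mulPerm hcop * inducedPerm n (braidDelta n) =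
      inducedPerm n (braidDelta n ^ k) * mulPerm hcop := by
  ext1 x
  rw [Equiv.Perm.mul_apply, Equiv.Perm.mul_apply]
  apply eq_of_modEq_of_mem
  have hx := Finset.mem_Icc.1 x.2
  have h1 : (mulPerm hcop (inducedPerm n (braidDelta n) x)).1 + k ≡ k * x.1 [MOD n] := by
    refine ((mulRep_modEq n k _).add_right k).trans ?_
    rw [delta_perm_val]
    split_ifs with h
    · rw [h, mul_one]
      simp [Nat.ModEq]
    · obtain ⟨j, hj⟩ : ∃ j, x.1 = j + 1 := ⟨x.1 - 1, by omega⟩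
      rw [hj, Nat.add_sub_cancel, mul_add, mul_one]
  have h2 : (inducedPerm n (braidDelta n ^ k) (mulPerm hcop x)).1 + k ≡ k * x.1 [MOD n] := by
    refine Nat.ModEq.trans ?_ (mulRep_modEq n k x)
    change _ ≡ (mulPerm hcop x).1 [MOD n]
    rw [delta_pow_perm_val hkn]
    split_ifs with h
    · rw [Nat.sub_add_cancel (by omega)]
      simp [Nat.ModEq]
    · rw [Nat.sub_add_cancel (by omega)]
  exact Nat.ModEq.add_right_cancel' k (h1.trans h2.symm)

theorem mulPerm_top {n k : ℕ} (hcop : n.Coprime k) (x : BraidPt n) (hx : x.1 = n) :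
    (mulPerm hcop x).1 = n := by
  change (mulRep n k x).1 = n
  unfold mulRep
  simp [hx]

/-- The left side has one more factor, the one at index 0, which is U_1 = 1. -/
theorem prodU_eq {n k : ℕ} (hcop : n.Coprime k) {m : ℕ} (hm : m < k) :
    prodU n (strandIndex n k) (m + 1) =
      ((List.range' 1 m).map fun i => braidU n (ceilIndex n k i)).prod := by
  induction m with
  | zero => simp [prodU, strandIndex, braidU_one]
  | succ m ih =>
    rw [prodU, ih (by omega), List.range'_concat]
    simp [← ceilIndex_eq hcop (Nat.succ_le_succ (Nat.zero_le m)) hm, add_comm]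

/-! ### The conjugation by X -/

theorem delta_pow_mul_eq {n k : ℕ} (hcop : n.Coprime k) (hk : 2 ≤ k) (hkn : k ≤ n - 1)
    {X : BraidGroup n} (hX : IsPermutationBraid X) (eX : inducedPerm n X = mulPerm hcop) :
    braidDelta n ^ k * X = X * deltaUProd n k := by
  set b := strandIndex n k with hbdef
  have hb : ∀ l m, l < m → m < k → b l < b m := fun l m h _ =>
    strandIndex_lt (by omega) (by omega) h
  have hn : ∀ m < k, b m ≤ n := fun m h => strandIndex_le (by omega) h
  have hlow : ∀ m < k, m + 1 ≤ b m := fun m _ => strandIndex_ge (by omega) (by omega) m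
  have hW := isPermutationBraid_shuffle hb hn hlow le_rfl
  have hV := isPermutationBraid_revShuffle hb hn hlow le_rfl
  have eV := revShuffle_perm hn hlow le_rfl
  have mW := shuffle_perm_mem hb hn hlow le_rfl
  have iW := shuffle_perm_inversion hb hn hlow le_rfl
  have eT := fullTwist_mul_shuffle hb hn hlow le_rfl
  have mX : ∀ x, (inducedPerm n X x).1 ≤ k ↔ (inducedPerm n (shuffle n b k) x).1 ≤ k := fun x => by
    rw [mW, eX, mulPerm_le_iff hcop (by omega) (by omega)]
  obtain ⟨P, hP, eP⟩ := exists_isPermutationBraid (inducedPerm n (braidDelta n ^ k))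
  obtain ⟨Y, hY, eY⟩ := exists_isPermutationBraid
    (inducedPerm n X * (inducedPerm n (shuffle n b k))⁻¹)
  have mY : ∀ x, (inducedPerm n Y x).1 ≤ k ↔ x.1 ≤ k := fun x => by
    rw [eY, Equiv.Perm.mul_apply, mX, Equiv.Perm.inv_def, Equiv.apply_symm_apply]
  have hYW : ∀ x, inducedPerm n Y (inducedPerm n (shuffle n b k) x) = inducedPerm n X x :=
    fun x => by rw [eY, ← Equiv.Perm.mul_apply, inv_mul_cancel_right]
  have h1 : X = Y * shuffle n b k := by
    refine hX.eq (hY.mul hW fun x y hxy h => ?_) (by rw [map_mul, eY, inv_mul_cancel_right])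
    have := iW x y hxy h
    rw [hYW, hYW]
    have := mX x
    have := mX y
    omega
  have h2 : Commute (fullTwist n k) Y := by
    refine hY.isReducedLift.commute (fun p hp => ?_) mY
    rw [← braidSigma_val]
    exact fullTwist_commute_sigma (by omega) (Finset.mem_Ico.1 p.2).1 hp
  have hδ : IsPermutationBraid (braidDelta n) :=
    isPermutationBraid_descProd le_rfl (by omega) le_rfl
  -- Every crossing of δ involves the strand joining the right endpoint 1 to n. The permutation of X
  -- fixes n, the largest point, so no such crossing is undone.
  have hXδ : IsPermutationBraid (X * braidDelta n) := by
    refine hX.mul hδ fun x y hxy h => ?_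
    have hx := Finset.mem_Icc.1 x.2
    have hy := Finset.mem_Icc.1 y.2
    have hx1 : x.1 = 1 := by
      rw [delta_perm_val, delta_perm_val] at h
      split_ifs at h <;> omega
    have ht : (inducedPerm n X (inducedPerm n (braidDelta n) x)).1 = n := by
      rw [eX, mulPerm_top]
      rw [delta_perm_val, if_pos hx1]
    rw [ht]
    refine lt_of_le_of_ne (Finset.mem_Icc.1 (Subtype.property _)).2 fun hc => ?_
    have := (inducedPerm n X).injective (Subtype.ext (ht.trans hc.symm))
    rw [this] at h
    omega
  have eXδ : inducedPerm n (X * braidDelta n) =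
      inducedPerm n (braidDelta n ^ k) * inducedPerm n X := by
    rw [map_mul, eX, mulPerm_mul_delta hcop (by omega)]
  have h3 : P * Y = X * braidDelta n * revShuffle n b k := by
    refine (hP.mul hY fun x y hxy h => ?_).eq (hXδ.mul hV fun x y hxy h => ?_) ?_
    -- A pair inverted by Y lies on one side of k, where the permutation of δ^k preserves the order.
    · have := mY x
      have := mY y
      rw [eP, delta_pow_perm_val (by omega), delta_pow_perm_val (by omega)]
      split_ifs <;> omega
    -- A pair inverted by V has x ≤ k < y. By `mX`, X keeps the two strands on these sides of k, and
    -- the permutation of δ^k puts the block {1, …, k} above the rest, so the pair stays inverted.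
    · rw [eV, Equiv.Perm.inv_def] at h ⊢
      have := iW _ _ h
      rw [Equiv.apply_symm_apply, Equiv.apply_symm_apply] at this
      have := this hxy
      have hx := mX ((inducedPerm n (shuffle n b k)).symm x)
      have hy := mX ((inducedPerm n (shuffle n b k)).symm y)
      rw [Equiv.apply_symm_apply] at hx hy
      have := Finset.mem_Icc.1 (inducedPerm n X ((inducedPerm n (shuffle n b k)).symm x)).2
      have := Finset.mem_Icc.1 (inducedPerm n X ((inducedPerm n (shuffle n b k)).symm y)).2
      rw [eXδ, Equiv.Perm.mul_apply, Equiv.Perm.mul_apply, delta_pow_perm_val (by omega),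
        delta_pow_perm_val (by omega)]
      split_ifs <;> omega
    · rw [map_mul, map_mul, eXδ, eP, eY, eV, mul_assoc]
  have e : deltaUProd n k = braidDelta n * prodU n b k := by
    obtain ⟨m, rfl⟩ : ∃ m, k = m + 1 := ⟨k - 1, by omega⟩
    rw [hbdef, prodU_eq hcop (Nat.lt_succ_self m)]
    rfl
  calc braidDelta n ^ k * X = P * (fullTwist n k * Y) * shuffle n b k := by
        rw [delta_pow_eq (by omega) hP eP, h1]; simp only [mul_assoc]
    _ = P * Y * (fullTwist n k * shuffle n b k) := by rw [h2.eq]; simp only [mul_assoc]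
    _ = X * deltaUProd n k := by rw [eT, h3, e]; group

theorem mainTheorem3 (n k : ℕ) (hcop : n.Coprime k) (hk : 2 ≤ k) (hkn : k ≤ n - 1) :
    IsConj (braidDelta n ^ k) (deltaUProd n k) ∧
    (∃! X : BraidGroup n, IsPermutationBraid X ∧ inducedPerm n X = mulPerm hcop) ∧
    (∀ X : BraidGroup n, IsPermutationBraid X → inducedPerm n X = mulPerm hcop →
      X⁻¹ * braidDelta n ^ k * X = deltaUProd n k) := by
  have key : ∀ X : BraidGroup n, IsPermutationBraid X → inducedPerm n X = mulPerm hcop →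
      X⁻¹ * braidDelta n ^ k * X = deltaUProd n k := fun X hX eX => by
    rw [mul_assoc, delta_pow_mul_eq hcop hk hkn hX eX, inv_mul_cancel_left]
  obtain ⟨X, hX, eX⟩ := exists_isPermutationBraid (mulPerm hcop)
  refine ⟨isConj_iff.2 ⟨X⁻¹, ?_⟩, ⟨X, ⟨hX, eX⟩, fun Y hY => hY.1.eq hX (hY.2.trans eX.symm)⟩, key⟩
  rw [inv_inv, key X hX eX]
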